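/- An association scheme on a finite set $\Omega$ is a pair $\mathcal X=(\Omega,S)$, where $S$ is a partition of $\Omega\times\Omega$ such that the diagonal $1_\Omega$ belongs to $S$, $s^*=\{(\beta,\alpha):(\alpha,\beta)\in s\}\in S$ for all $s\in S$, and for all $r,s,t\in S$ the number $c_{rs}^t=|\{\gamma\in\Omega:(\alpha,\gamma)\in r,\ (\gamma,\beta)\in s\}|$ does not depend on the choice of $(\alpha,\beta)\in t$. Its degree is $|\Omega|$, and the valency of $s\in S$ is $n_s=c_{ss^*}^{1_\Omega}$. The adjacency algebra of $\mathcal X$ is the subalgebra of $\mathrm{Mat}_\Omega(\mathbb C)$ generated (equivalently, spanned) by the adjacency matrices $A_s$, $s\in S$. For an irreducible character $\chi$ of this algebra let $n_\chi$ be its degree and $m_\chi$ its multiplicity in the standard module $\mathbb C^\Omega$; $\chi$ is principal if it is afforded by the one-dimensional representation $A_s\mapsto n_s$. The scheme is pseudocyclic if the ratio $m_\chi/n_\chi$ is the same for all nonprincipal irreducible characters $\chi$. A pseudocyclic scheme is said to have valency $k$ if $n_s=k$ for some basis relation $s\ne 1_\Omega$ (all such relations then have valency $k$). The scheme $\mathcal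 X$ is schurian if $S$ is the set of orbits on $\Omega\times\Omega$ of some transitive permutation group on $\Omega$. It is separable if for every scheme $\mathcal X'=(\Omega',S')$ and every bijection $\varphi:S\to S'$ with $c_{rs}^t=c_{\varphi(r)\varphi(s)}^{\varphi(t)}$ for all $r,s,t\in S$, there is a bijection $f:\Omega\to\Omega'$ that maps each $s\in S$ onto $\varphi(s)$. **Corollary.** There exists a function $f:\mathbb N\to\mathbb N$ with $f(k)\le 1+3k^6$ for all $k$ such that, for every integer $k>1$, every pseudocyclic scheme of valency $k$ and degree at least $f(k)$ is schurian and separable. -/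

import Mathlib

universe u v

/-- An association scheme on a finite set `Ω`: a partition of `Ω × Ω` into basis relations that
contains the diagonal, is closed under reversing relations, and for which the number of `γ` with
`(α, γ) ∈ r` and `(γ, β) ∈ s` is the same for all pairs `(α, β)` of a basis relation `t`. -/
structure AssociationScheme (Ω : Type u) [Fintype Ω] where
  /-- the set `S` of basis relations -/
  rels : Set (Set (Ω × Ω))
  isPartition : Setoid.IsPartition rels
  diagonal_mem : Set.diagonal Ω ∈ rels
  swap_mem : ∀ s ∈ rels, Prod.swap ⁻¹' s ∈ rels
  regular : ∀ r ∈ rels, ∀ s ∈ rels, ∀ t ∈ rels, ∀ p ∈ t, ∀ q ∈ t,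
    Set.ncard {γ | (p.1, γ) ∈ r ∧ (γ, p.2) ∈ s} = Set.ncard {γ | (q.1, γ) ∈ r ∧ (γ, q.2) ∈ s}

namespace AssociationScheme

variable {Ω : Type u} [Fintype Ω] {Ω' : Type v} [Fintype Ω']

/-- Basis relations are non-empty. -/
theorem rels_nonempty (X : AssociationScheme Ω) (t : X.rels) : (t : Set (Ω × Ω)).Nonempty :=
  Setoid.nonempty_of_mem_partition X.isPartition t.2

/-- The diagonal as a basis relation. -/
def diag (X : AssociationScheme Ω) : X.rels := ⟨Set.diagonal Ω, X.diagonal_mem⟩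

/-- The reversed basis relation `s*`. -/
def star (X : AssociationScheme Ω) (s : X.rels) : X.rels :=
  ⟨Prod.swap ⁻¹' (s : Set (Ω × Ω)), X.swap_mem s s.2⟩

/-- The intersection number `c_{rs}^t`, computed at some pair in `t`;
`interNum_eq` shows that the choice is irrelevant. -/
noncomputable def interNum (X : AssociationScheme Ω) (r s t : X.rels) : ℕ :=
  Set.ncard {γ | ((X.rels_nonempty t).some.1, γ) ∈ (r : Set (Ω × Ω)) ∧
    (γ, (X.rels_nonempty t).some.2) ∈ (s : Set (Ω × Ω))}

theorem interNum_eq (X : AssociationScheme Ω) (r s t : X.rels) {α β : Ω}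
    (h : (α, β) ∈ (t : Set (Ω × Ω))) :
    X.interNum r s t =
      Set.ncard {γ | (α, γ) ∈ (r : Set (Ω × Ω)) ∧ (γ, β) ∈ (s : Set (Ω × Ω))} :=
  X.regular r r.2 s s.2 t t.2 _ (X.rels_nonempty t).some_mem (α, β) h

/-- The valency `n_s = c_{s s*}^1` of a basis relation. -/
noncomputable def valency (X : AssociationScheme Ω) (s : X.rels) : ℕ :=
  X.interNum s (X.star s) X.diag

theorem valency_eq (X : AssociationScheme Ω) (s : X.rels) (α : Ω) :
    X.valency s = Set.ncard {β | (α, β) ∈ (s : Set (Ω × Ω))} := by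
  rw [valency, X.interNum_eq s (X.star s) X.diag (α := α) (β := α) rfl]
  simp [star]

/-- `X` is schurian: its basis relations are the orbits on `Ω × Ω` of some transitive
permutation group on `Ω`. -/
def IsSchurian (X : AssociationScheme Ω) : Prop :=
  ∃ K : Subgroup (Equiv.Perm Ω), MulAction.IsPretransitive K Ω ∧
    X.rels = Set.range fun p : Ω × Ω => MulAction.orbit K p

/-- A bijection between the sets of basis relations is an algebraic isomorphism if it preserves
the intersection numbers. -/
def IsAlgebraicIso (X : AssociationScheme Ω) (X' : AssociationScheme Ω')
    (φ : X.rels ≃ X'.rels) : Prop :=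
  ∀ r s t : X.rels, X.interNum r s t = X'.interNum (φ r) (φ s) (φ t)

/-- The bijection `f` of the point sets is an isomorphism from `X` to `X'` inducing `φ`. -/
def Induces (X : AssociationScheme Ω) (X' : AssociationScheme Ω')
    (f : Ω ≃ Ω') (φ : X.rels ≃ X'.rels) : Prop :=
  ∀ s : X.rels, Prod.map f f '' (s : Set (Ω × Ω)) = (φ s : Set (Ω' × Ω'))

/-- `X` is separable: every algebraic isomorphism from `X` to a scheme is induced by an
isomorphism. -/
def IsSeparable (X : AssociationScheme.{u} Ω) : Prop :=
  ∀ (Ω' : Type v) [Fintype Ω'] (X' : AssociationScheme.{v} Ω') (φ : X.rels ≃ X'.rels),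
    X.IsAlgebraicIso X' φ → ∃ f : Ω ≃ Ω', X.Induces X' f φ

/-- The operator on `ℂ^Ω` given by the adjacency matrix (the 0-1 matrix) of a basis relation. -/
noncomputable def adjOp (X : AssociationScheme Ω) (s : X.rels) : Module.End ℂ (Ω → ℂ) :=
  Matrix.mulVecLin
    (Matrix.of fun α β : Ω => (s : Set (Ω × Ω)).indicator (fun _ => (1 : ℂ)) (α, β))

/-- The (complex) adjacency algebra of `X`, acting on its standard module `ℂ^Ω`. -/
noncomputable def adjAlgebra (X : AssociationScheme Ω) : Subalgebra ℂ (Module.End ℂ (Ω → ℂ)) :=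
  Algebra.adjoin ℂ (Set.range X.adjOp)

/-- The adjacency matrix of a basis relation as an element of the adjacency algebra. -/
noncomputable def adj (X : AssociationScheme Ω) (s : X.rels) : X.adjAlgebra :=
  ⟨X.adjOp s, Algebra.subset_adjoin (Set.mem_range_self s)⟩

section Characters

variable (X : AssociationScheme Ω) (V : Type u) [AddCommGroup V] [Module ℂ V]
  [Module X.adjAlgebra V] [IsScalarTower ℂ X.adjAlgebra V]

/-- The (simple) module `V` affords the principal character: every adjacency matrix acts as
multiplication by the valency. -/
def IsPrincipal : Prop :=
  ∀ (s : X.rels) (x : V), X.adj s • x = (X.valency s : ℂ) • x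

/-- The multiplicity of the simple module `V` in the standard module `ℂ^Ω`, that is, the dimension
of the space of module homomorphisms from `V` to `ℂ^Ω`. -/
noncomputable def multiplicity : ℕ :=
  Module.finrank ℂ (V →ₗ[X.adjAlgebra] (Ω → ℂ))

end Characters

/-- `X` is pseudocyclic: the ratio of multiplicity (in the standard module) and degree is the same
for all nonprincipal irreducible characters of the adjacency algebra. Irreducible characters are
represented by the simple modules affording them; up to isomorphism, all of these
(quotients of the algebra) live in the universe of `Ω`. -/
def IsPseudocyclic (X : AssociationScheme Ω) : Prop :=
  ∃ c : ℚ, ∀ (V : Type u) [AddCommGroup V] [Module ℂ V] [Module X.adjAlgebra V]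
    [IsScalarTower ℂ X.adjAlgebra V], IsSimpleModule X.adjAlgebra V → ¬ X.IsPrincipal V →
    (X.multiplicity V : ℚ) / (Module.finrank ℂ V : ℚ) = c

end AssociationScheme

/-! Let n be the degree. If multiplicity over degree equals c for all nonprincipal irreducible
characters, the standard character is c(ρ - π) + π, with ρ the regular and π the principal
character. It is n at the identity and 0 at the other adjacency matrices, so n = c(|S| - 1) + 1 and
n_s = c(n_s - ∑ₜ c_{st}^t) for s ≠ 1. The bracket is a positive integer, whence n_s ≥ c; the n_s
with s ≠ 1 add up to c(|S| - 1), so each is c = k and the bracket is 1. Since c_{tt*}^s = c_{st}^t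
for t ≠ 1, fewer than k points fail to distinguish two given points
(`IsPseudocyclic.card_indistinguishing_lt`).

The rest is combinatorial. For an algebraic isomorphism φ, the graph of an isomorphism inducing φ is
a set of pairwise compatible pairs in Ω × Ω'. Fix a pair a. Relative to a and a compatible p, every
point of Ω lifts to a compatible pair, uniquely in the linked case. Each condition imposed on an
auxiliary point excludes at most k³ points, so if n > 1 + 6k³ six conditions can be met at once
(`exists_generic`). Such points show that pairs near a common pair are compatible
(`Near.compatible_of_near`) and that having a common near neighbour is transitive
(`exists_near_trans`). Lifts sharing a near neighbour with a given b then form, with a, the graph of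
an isomorphism through a and b (`exists_induces`). The identity φ gives schurity, arbitrary φ
separability. -/

namespace AssociationScheme

open scoped Classical

/-! ### Basis relations and intersection numbers. -/

section Relations

variable {Ω : Type u} [Fintype Ω]
  (X : AssociationScheme Ω)

noncomputable instance : Fintype X.rels := Fintype.ofFinite _

/-- The basis relation containing the pair `(α, β)`. -/
noncomputable def rel (α β : Ω) : X.rels :=
  ⟨(X.isPartition.2 (α, β)).choose, (X.isPartition.2 (α, β)).choose_spec.1.1⟩

theorem mem_rel (α β : Ω) : (α, β) ∈ (X.rel α β : Set (Ω × Ω)) :=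
  (X.isPartition.2 (α, β)).choose_spec.1.2

theorem rel_eq_iff {α β : Ω} {s : X.rels} : X.rel α β = s ↔ (α, β) ∈ (s : Set (Ω × Ω)) := by
  constructor
  · rintro rfl
    exact X.mem_rel α β
  · intro h
    exact Subtype.ext ((X.isPartition.2 (α, β)).unique ⟨(X.rel α β).2, X.mem_rel α β⟩ ⟨s.2, h⟩)

theorem exists_rel_eq (s : X.rels) : ∃ α β, X.rel α β = s := by
  obtain ⟨⟨α, β⟩, h⟩ := X.rels_nonempty s
  exact ⟨α, β, X.rel_eq_iff.2 h⟩

theorem rel_eq_diag {α β : Ω} : X.rel α β = X.diag ↔ α = β := by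
  rw [rel_eq_iff]
  exact Iff.rfl

theorem rel_self (α : Ω) : X.rel α α = X.diag := X.rel_eq_diag.2 rfl

theorem star_rel (α β : Ω) : X.star (X.rel α β) = X.rel β α := by
  symm
  rw [rel_eq_iff]
  exact X.mem_rel α β

theorem star_star (s : X.rels) : X.star (X.star s) = s := by
  obtain ⟨α, β, rfl⟩ := X.exists_rel_eq s
  rw [star_rel, star_rel]

theorem rel_eq_rel_comm {α β γ δ : Ω} : X.rel α β = X.rel γ δ ↔ X.rel β α = X.rel δ γ := by
  rw [← X.star_rel α β, ← X.star_rel γ δ]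
  exact ⟨fun h => by rw [h], fun h => by simpa [star_star] using congrArg X.star h⟩

theorem interNum_rel (r s : X.rels) (α β : Ω) :
    X.interNum r s (X.rel α β) =
      (Finset.univ.filter fun γ => X.rel α γ = r ∧ X.rel γ β = s).card := by
  rw [X.interNum_eq r s _ (X.mem_rel α β), ← Set.ncard_coe_finset]
  congr 1
  ext γ
  simp [rel_eq_iff]

theorem interNum_rel_pos {r s : X.rels} {α β : Ω} :
    0 < X.interNum r s (X.rel α β) ↔ ∃ γ, X.rel α γ = r ∧ X.rel γ β = s := by
  simp [interNum_rel, Finset.card_pos, Finset.Nonempty]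

theorem valency_eq_card (s : X.rels) (α : Ω) :
    X.valency s = (Finset.univ.filter fun β => X.rel α β = s).card := by
  rw [X.valency_eq s α, ← Set.ncard_coe_finset]
  congr 1
  ext γ
  simp [rel_eq_iff]

theorem valency_pos (s : X.rels) : 0 < X.valency s := by
  obtain ⟨α, β, rfl⟩ := X.exists_rel_eq s
  rw [X.valency_eq_card _ α, Finset.card_pos]
  exact ⟨β, by simp⟩

theorem exists_rel_eq_left (s : X.rels) (α : Ω) : ∃ β, X.rel α β = s := by
  have h := X.valency_pos s
  rw [X.valency_eq_card s α, Finset.card_pos] at h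
  obtain ⟨β, hβ⟩ := h
  exact ⟨β, by simpa using hβ⟩

theorem valency_diag : X.valency X.diag = 1 := by
  obtain ⟨α, -, -⟩ := X.exists_rel_eq X.diag
  rw [X.valency_eq_card _ α, Finset.card_eq_one]
  refine ⟨α, ?_⟩
  ext β
  rw [Finset.mem_filter, rel_eq_diag, Finset.mem_singleton, eq_comm]
  simp

theorem sum_valency : ∑ s, X.valency s = Fintype.card Ω := by
  obtain ⟨α, -, -⟩ := X.exists_rel_eq X.diag
  simp_rw [fun s => X.valency_eq_card s α]
  exact (Finset.card_eq_sum_card_fiberwise (f := X.rel α) (by simp)).symm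

/-- Counting the triangles with prescribed sides at a point in two ways. -/
theorem interNum_mul_valency (x y z : X.rels) :
    X.interNum x z y * X.valency y = X.interNum y (X.star z) x * X.valency x := by
  obtain ⟨α, -, -⟩ := X.exists_rel_eq X.diag
  have h := Finset.sum_card_bipartiteAbove_eq_sum_card_bipartiteBelow
    (s := Finset.univ.filter fun β => X.rel α β = x)
    (t := Finset.univ.filter fun δ => X.rel α δ = y) (fun β δ => X.rel β δ = z)
  have h1 : ∀ β ∈ Finset.univ.filter fun β => X.rel α β = x,
      (Finset.bipartiteAbove (fun β δ => X.rel β δ = z)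
        (Finset.univ.filter fun δ => X.rel α δ = y) β).card = X.interNum y (X.star z) x := by
    intro β hβ
    obtain rfl : X.rel α β = x := by simpa using hβ
    rw [interNum_rel, Finset.bipartiteAbove, Finset.filter_filter]
    congr 1
    ext δ
    simp only [Finset.mem_filter, Finset.mem_univ, true_and]
    refine and_congr_right fun _ => ?_
    rw [← X.star_rel β δ]
    exact ⟨fun h => by rw [h], fun h => by simpa [star_star] using congrArg X.star h⟩
  have h2 : ∀ δ ∈ Finset.univ.filter fun δ => X.rel α δ = y,
      (Finset.bipartiteBelow (fun β δ => X.rel β δ = z)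
        (Finset.univ.filter fun β => X.rel α β = x) δ).card = X.interNum x z y := by
    intro δ hδ
    obtain rfl : X.rel α δ = y := by simpa using hδ
    rw [interNum_rel, Finset.bipartiteBelow, Finset.filter_filter]
  rw [Finset.sum_congr rfl h1, Finset.sum_congr rfl h2] at h
  simp only [Finset.sum_const, smul_eq_mul, ← valency_eq_card] at h
  rw [mul_comm, ← h, mul_comm]

/-- The points that do not distinguish `α` from `β` are counted by intersection numbers. -/
theorem card_indistinguishing (α β : Ω) :
    (Finset.univ.filter fun γ => X.rel α γ = X.rel β γ).card =
      ∑ t, X.interNum t (X.star t) (X.rel α β) := by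
  rw [Finset.card_eq_sum_card_fiberwise (f := X.rel α) (t := Finset.univ) (by simp)]
  refine Finset.sum_congr rfl fun t _ => ?_
  rw [interNum_rel, Finset.filter_filter]
  congr 1
  ext γ
  simp only [Finset.mem_filter, Finset.mem_univ, true_and]
  constructor
  · rintro ⟨h1, rfl⟩
    rw [h1, star_rel]
    exact ⟨rfl, rfl⟩
  · rintro ⟨rfl, h⟩
    rw [star_rel, X.rel_eq_rel_comm] at h
    exact ⟨h.symm, rfl⟩

end Relations

/-! ### Algebraic isomorphisms and compatible pairs. -/

section AlgebraicIso

variable {Ω : Type u} [Fintype Ω] {Ω' : Type v} [Fintype Ω']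
  {X : AssociationScheme Ω} {X' : AssociationScheme Ω'} {φ : X.rels ≃ X'.rels}

/-- The inequality c_{φ(1),1'}^{φ(1)} > 0 pulls back to c_{1,φ⁻¹(1')}^1 > 0, which forces φ⁻¹(1') =
1. -/
theorem IsAlgebraicIso.map_diag (h : X.IsAlgebraicIso X' φ) : φ X.diag = X'.diag := by
  obtain ⟨α, -, -⟩ := X.exists_rel_eq X.diag
  obtain ⟨α', β', hαβ⟩ := X'.exists_rel_eq (φ X.diag)
  have h1 : 0 < X'.interNum (φ X.diag) X'.diag (X'.rel α' β') :=
    X'.interNum_rel_pos.2 ⟨β', hαβ, X'.rel_self _⟩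
  rw [hαβ, ← φ.apply_symm_apply X'.diag, ← h, ← X.rel_self α, X.interNum_rel_pos] at h1
  obtain ⟨γ, h2, h3⟩ := h1
  rw [X.rel_self, X.rel_eq_diag] at h2
  rw [← h2, X.rel_self] at h3
  rw [h3, φ.apply_symm_apply]

theorem IsAlgebraicIso.map_star (h : X.IsAlgebraicIso X' φ) (s : X.rels) :
    φ (X.star s) = X'.star (φ s) := by
  obtain ⟨α, β, rfl⟩ := X.exists_rel_eq s
  have h1 : 0 < X.interNum (X.rel α β) (X.rel β α) (X.rel α α) :=
    X.interNum_rel_pos.2 ⟨β, rfl, rfl⟩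
  obtain ⟨α', -, -⟩ := X'.exists_rel_eq X'.diag
  rw [h, X.rel_self, h.map_diag, ← X'.rel_self α', X'.interNum_rel_pos] at h1
  obtain ⟨γ, h2, h3⟩ := h1
  rw [X.star_rel, ← h2, ← h3, X'.star_rel]

theorem IsAlgebraicIso.valency_map (h : X.IsAlgebraicIso X' φ) (s : X.rels) :
    X'.valency (φ s) = X.valency s := by
  rw [valency, valency, ← h.map_star, ← h.map_diag, ← h]

theorem IsAlgebraicIso.card_eq (h : X.IsAlgebraicIso X' φ) :
    Fintype.card Ω = Fintype.card Ω' := by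
  rw [← X.sum_valency, ← X'.sum_valency, ← φ.sum_comp]
  exact Finset.sum_congr rfl fun s _ => (h.valency_map s).symm

theorem IsAlgebraicIso.symm (h : X.IsAlgebraicIso X' φ) : X'.IsAlgebraicIso X φ.symm := by
  intro r s t
  rw [h]
  simp

/-- Two pairs of corresponding points are compatible with `φ` if their relations correspond
under `φ`. -/
def Compatible (φ : X.rels ≃ X'.rels) (p q : Ω × Ω') : Prop :=
  X'.rel p.2 q.2 = φ (X.rel p.1 q.1)

theorem IsAlgebraicIso.compatible_symm (h : X.IsAlgebraicIso X' φ) {p q : Ω × Ω'}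
    (hpq : Compatible φ p q) : Compatible φ q p := by
  rw [Compatible, ← X'.star_rel, ← X.star_rel, hpq, h.map_star]

theorem IsAlgebraicIso.compatible_self (h : X.IsAlgebraicIso X' φ) (p : Ω × Ω') :
    Compatible φ p p := by
  rw [Compatible, X'.rel_self, X.rel_self, h.map_diag]

theorem IsAlgebraicIso.fst_eq_iff (h : X.IsAlgebraicIso X' φ) {p q : Ω × Ω'}
    (hpq : Compatible φ p q) : p.1 = q.1 ↔ p.2 = q.2 := by
  rw [← X.rel_eq_diag, ← X'.rel_eq_diag, hpq, ← h.map_diag, φ.apply_eq_iff_eq]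

/-- A triangle on the edge from `a` to `p` has a counterpart in Ω' because the intersection number
counting it is preserved and positive. Uniqueness of the counterpart needs linkedness. -/
theorem IsAlgebraicIso.exists_compatible (h : X.IsAlgebraicIso X' φ) {a p : Ω × Ω'}
    (hap : Compatible φ a p) (γ : Ω) :
    ∃ γ', Compatible φ a (γ, γ') ∧ Compatible φ p (γ, γ') := by
  have h1 : 0 < X.interNum (X.rel a.1 γ) (X.rel γ p.1) (X.rel a.1 p.1) :=
    X.interNum_rel_pos.2 ⟨γ, rfl, rfl⟩
  rw [h, ← hap, X'.interNum_rel_pos] at h1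
  obtain ⟨γ', h2, h3⟩ := h1
  exact ⟨γ', h2, h.compatible_symm h3⟩

theorem IsAlgebraicIso.exists_compatible' (h : X.IsAlgebraicIso X' φ) {a p : Ω × Ω'}
    (hap : Compatible φ a p) (γ' : Ω') :
    ∃ γ, Compatible φ a (γ, γ') ∧ Compatible φ p (γ, γ') := by
  have h1 : 0 < X'.interNum (X'.rel a.2 γ') (X'.rel γ' p.2) (X'.rel a.2 p.2) :=
    X'.interNum_rel_pos.2 ⟨γ', rfl, rfl⟩
  rw [h.symm, hap, φ.symm_apply_apply, X.interNum_rel_pos] at h1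
  obtain ⟨γ, h2, h3⟩ := h1
  refine ⟨γ, ?_, h.compatible_symm ?_⟩ <;> simp [Compatible, h2, h3]

/-- Two basis relations `x`, `y` are linked if, seen from a point `α` and a point `δ` with
`(α, δ) ∈ y`, the points `β` with `(α, β) ∈ x` are distinguished by their relation to `δ`. -/
def Linked (X : AssociationScheme Ω) (x y : X.rels) : Prop :=
  ∀ z, X.interNum x z y ≤ 1

/-- For equal valencies, counting triangles gives c_{yz}^x = c_{xz*}^y. -/
theorem Linked.symm {x y : X.rels} (h : X.Linked x y) (hxy : X.valency x = X.valency y) :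
    X.Linked y x := by
  intro z
  have h1 := X.interNum_mul_valency x y (X.star z)
  rw [X.star_star, hxy] at h1
  rw [← Nat.eq_of_mul_eq_mul_right (X.valency_pos y) h1]
  exact h _

theorem IsAlgebraicIso.eq_of_linked (h : X.IsAlgebraicIso X' φ) {a p : Ω × Ω'} {δ : Ω}
    {δ₁ δ₂ : Ω'} (hl : X.Linked (X.rel a.1 δ) (X.rel a.1 p.1)) (hap : Compatible φ a p)
    (h1 : Compatible φ a (δ, δ₁)) (h2 : Compatible φ p (δ, δ₁))
    (h3 : Compatible φ a (δ, δ₂)) (h4 : Compatible φ p (δ, δ₂)) : δ₁ = δ₂ := by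
  have hc := hl (X.rel δ p.1)
  rw [h, ← hap, X'.interNum_rel, Finset.card_le_one] at hc
  refine hc _ ?_ _ ?_
  · simpa using ⟨h1, h.compatible_symm h2⟩
  · simpa using ⟨h3, h.compatible_symm h4⟩

/-- If `ω ∉ X.ambiguous α δ ε` then the relation between `δ` and `ε` can be recovered from their
relations to `α` and `ω`. -/
noncomputable def ambiguous (X : AssociationScheme Ω) (α δ ε : Ω) : Finset Ω :=
  Finset.univ.filter fun ω => ∃ ε₁ ε₂, X.rel α ε₁ = X.rel α ε ∧ X.rel δ ε₂ = X.rel δ ε₁ ∧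
    ε₂ ≠ ε ∧ X.rel ε₂ ω = X.rel ε ω

/-- Pull `q.2` back to Ω twice, along the edge `a`, `p` and along the edge `w`, `p`. The two
preimages have the same relation to `p.1`, so they would witness ambiguity of `w.1` unless the
second one is `q.1`. -/
theorem IsAlgebraicIso.compatible_of_notMem_ambiguous (h : X.IsAlgebraicIso X' φ)
    {a w p q : Ω × Ω'} (hw : w.1 ∉ X.ambiguous a.1 p.1 q.1) (hap : Compatible φ a p)
    (haq : Compatible φ a q) (hwp : Compatible φ w p) (hwq : Compatible φ w q) :
    Compatible φ p q := by
  obtain ⟨ε₁, h1, h2⟩ := h.exists_compatible' hap q.2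
  obtain ⟨ε₂, h3, h4⟩ := h.exists_compatible' hwp q.2
  have e1 : X.rel a.1 ε₁ = X.rel a.1 q.1 := φ.injective (h1.symm.trans haq)
  have e2 : X.rel p.1 ε₂ = X.rel p.1 ε₁ := φ.injective (h4.symm.trans h2)
  have e3 : X.rel w.1 ε₂ = X.rel w.1 q.1 := φ.injective (h3.symm.trans hwq)
  by_cases e : ε₂ = q.1
  · rw [e] at h4
    exact h4
  · exact absurd (by simpa [ambiguous] using ⟨ε₁, e1, ε₂, e2, e, X.rel_eq_rel_comm.1 e3⟩) hw

end AlgebraicIso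

/-! ### Counting bad points; existence of generic points. -/

section Generic

variable {Ω : Type u} [Fintype Ω] {X : AssociationScheme Ω} {k : ℕ}

/-- There are at most k choices for `ε₁`, then k for `ε₂`, then k points `ω` not distinguishing `ε₂`
from `ε`. -/
theorem card_ambiguous_le (hk : ∀ s, X.valency s ≤ k)
    (hc : ∀ α β : Ω, α ≠ β → (Finset.univ.filter fun γ => X.rel α γ = X.rel β γ).card ≤ k)
    (α δ ε : Ω) : (X.ambiguous α δ ε).card ≤ k ^ 3 := by
  have hsub : X.ambiguous α δ ε ⊆
      (Finset.univ.filter fun ε₁ => X.rel α ε₁ = X.rel α ε).biUnion fun ε₁ =>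
        (Finset.univ.filter fun ε₂ => X.rel δ ε₂ = X.rel δ ε₁).biUnion fun ε₂ =>
          Finset.univ.filter fun ω => ε₂ ≠ ε ∧ X.rel ε₂ ω = X.rel ε ω := by
    intro ω hω
    obtain ⟨ε₁, ε₂, h⟩ := (Finset.mem_filter.1 hω).2
    simp only [Finset.mem_biUnion, Finset.mem_filter, Finset.mem_univ, true_and]
    exact ⟨ε₁, h.1, ε₂, h.2⟩
  refine (Finset.card_le_card hsub).trans ?_
  have hk' : ∀ (β : Ω) (s : X.rels), (Finset.univ.filter fun γ => X.rel β γ = s).card ≤ k :=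
    fun β s => (X.valency_eq_card s β).symm.le.trans (hk s)
  refine (Finset.card_biUnion_le_card_mul _ _ (k * k) fun ε₁ _ =>
    (Finset.card_biUnion_le_card_mul _ _ k fun ε₂ _ => ?_).trans
      (Nat.mul_le_mul_right _ (hk' _ _))).trans
    ((Nat.mul_le_mul_right _ (hk' _ _)).trans_eq (by ring))
  by_cases e : ε₂ = ε
  · simp [e]
  · simpa [e] using hc ε₂ ε e

theorem card_not_linked_le (hk : ∀ s, X.valency s ≤ k)
    (hc : ∀ α β : Ω, α ≠ β → (Finset.univ.filter fun γ => X.rel α γ = X.rel β γ).card ≤ k)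
    (α β : Ω) :
    (Finset.univ.filter fun ω => ¬ X.Linked (X.rel α β) (X.rel α ω)).card ≤ k ^ 3 := by
  have hsub : (Finset.univ.filter fun ω => ¬ X.Linked (X.rel α β) (X.rel α ω)) ⊆
      (Finset.univ.filter fun β₁ => X.rel α β₁ = X.rel α β).biUnion fun β₁ =>
        (Finset.univ.filter fun β₂ => X.rel α β₂ = X.rel α β).biUnion fun β₂ =>
          Finset.univ.filter fun ω => β₁ ≠ β₂ ∧ X.rel β₁ ω = X.rel β₂ ω := by
    intro ω hω
    have h := (Finset.mem_filter.1 hω).2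
    simp only [Linked, not_forall, not_le] at h
    obtain ⟨z, hz⟩ := h
    rw [X.interNum_rel, Finset.one_lt_card] at hz
    obtain ⟨β₁, h1, β₂, h2, hne⟩ := hz
    simp only [Finset.mem_filter, Finset.mem_univ, true_and] at h1 h2
    simp only [Finset.mem_biUnion, Finset.mem_filter, Finset.mem_univ, true_and]
    exact ⟨β₁, h1.1, β₂, h2.1, hne, h1.2.trans h2.2.symm⟩
  refine (Finset.card_le_card hsub).trans ?_
  have hk' : ∀ (β : Ω) (s : X.rels), (Finset.univ.filter fun γ => X.rel β γ = s).card ≤ k :=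
    fun β s => (X.valency_eq_card s β).symm.le.trans (hk s)
  refine (Finset.card_biUnion_le_card_mul _ _ (k * k) fun β₁ _ =>
    (Finset.card_biUnion_le_card_mul _ _ k fun β₂ _ => ?_).trans
      (Nat.mul_le_mul_right _ (hk' _ _))).trans
    ((Nat.mul_le_mul_right _ (hk' _ _)).trans_eq (by ring))
  by_cases e : β₁ = β₂
  · simp [e]
  · simpa [e] using hc β₁ β₂ e

/-- Union bound: `α` and at most six bad sets of at most k³ points each cannot cover Ω. -/
theorem exists_generic (hk : ∀ s, X.valency s ≤ k)
    (hc : ∀ α β : Ω, α ≠ β → (Finset.univ.filter fun γ => X.rel α γ = X.rel β γ).card ≤ k)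
    (hn : 1 + 6 * k ^ 3 < Fintype.card Ω) (α : Ω) (L : Finset Ω) (T : Finset (Ω × Ω))
    (hLT : L.card + T.card ≤ 6) :
    ∃ ω, α ≠ ω ∧ (∀ β ∈ L, X.Linked (X.rel α β) (X.rel α ω)) ∧
      ∀ p ∈ T, ω ∉ X.ambiguous α p.1 p.2 := by
  by_contra! hcon
  have hsub : (Finset.univ : Finset Ω) ⊆ {α} ∪
      ((L.biUnion fun β => Finset.univ.filter fun ω => ¬ X.Linked (X.rel α β) (X.rel α ω)) ∪
        T.biUnion fun p => X.ambiguous α p.1 p.2) := by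
    intro ω _
    by_cases h1 : α = ω
    · simp [h1]
    by_cases h2 : ∀ β ∈ L, X.Linked (X.rel α β) (X.rel α ω)
    · obtain ⟨p, hp, hω⟩ := hcon ω h1 h2
      refine Finset.mem_union_right _ (Finset.mem_union_right _ ?_)
      exact Finset.mem_biUnion.2 ⟨p, hp, hω⟩
    · push Not at h2
      obtain ⟨β, hβ, hl⟩ := h2
      refine Finset.mem_union_right _ (Finset.mem_union_left _ ?_)
      exact Finset.mem_biUnion.2 ⟨β, hβ, by simpa using hl⟩
  have h1 := (Finset.card_le_card hsub).trans ((Finset.card_union_le _ _).trans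
    (Nat.add_le_add_left (Finset.card_union_le _ _) _))
  have h2 := Finset.card_biUnion_le_card_mul L
    (fun β => Finset.univ.filter fun ω => ¬ X.Linked (X.rel α β) (X.rel α ω)) (k ^ 3)
    fun β _ => card_not_linked_le hk hc α β
  have h3 := Finset.card_biUnion_le_card_mul T (fun p => X.ambiguous α p.1 p.2) (k ^ 3)
    fun p _ => card_ambiguous_le hk hc α p.1 p.2
  have h4 : (L.card + T.card) * k ^ 3 ≤ 6 * k ^ 3 := Nat.mul_le_mul_right _ hLT
  rw [Finset.card_univ, Finset.card_singleton] at h1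
  rw [add_mul] at h4
  omega

end Generic

/-! ### Extending two compatible pairs to an isomorphism. -/

section Extension

variable {Ω : Type u} [Fintype Ω] {Ω' : Type v} [Fintype Ω']
  {X : AssociationScheme Ω} {X' : AssociationScheme Ω'} {φ : X.rels ≃ X'.rels} {k : ℕ}

/-- Compatible pairs of points whose relations to `a` are compatible and linked. -/
structure Near (φ : X.rels ≃ X'.rels) (a p q : Ω × Ω') : Prop where
  ne_left : a.1 ≠ p.1
  ne_right : a.1 ≠ q.1
  left : Compatible φ a p
  right : Compatible φ a q
  linked : X.Linked (X.rel a.1 p.1) (X.rel a.1 q.1)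
  compatible : Compatible φ p q

theorem Near.symm {a p q : Ω × Ω'} (hpq : Near φ a p q) (h : X.IsAlgebraicIso X' φ)
    (hk : ∀ s, s ≠ X.diag → X.valency s = k) : Near φ a q p :=
  ⟨hpq.ne_right, hpq.ne_left, hpq.right, hpq.left,
    hpq.linked.symm (by
      rw [hk _ (X.rel_eq_diag.not.2 hpq.ne_left), hk _ (X.rel_eq_diag.not.2 hpq.ne_right)]),
    h.compatible_symm hpq.compatible⟩

theorem IsAlgebraicIso.exists_near (h : X.IsAlgebraicIso X' φ) {a p : Ω × Ω'} {ω : Ω}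
    (hp : a.1 ≠ p.1) (hap : Compatible φ a p) (hω : a.1 ≠ ω)
    (hl : X.Linked (X.rel a.1 p.1) (X.rel a.1 ω)) : ∃ ω', Near φ a p (ω, ω') := by
  obtain ⟨ω', h1, h2⟩ := h.exists_compatible hap ω
  exact ⟨ω', hp, hω, hap, h1, hl, h2⟩

variable (h : X.IsAlgebraicIso X' φ) (hk : ∀ s, s ≠ X.diag → X.valency s = k)
  (hk' : ∀ s, X.valency s ≤ k)
  (hc : ∀ α β : Ω, α ≠ β → (Finset.univ.filter fun γ => X.rel α γ = X.rel β γ).card ≤ k)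
  (hn : 1 + 6 * k ^ 3 < Fintype.card Ω)
include h hk

/-- Compatibility with `w` can be deduced from compatibility with a common neighbour. -/
theorem compatible_of_near_of_notMem_ambiguous {a p q w : Ω × Ω'} (hpw : Near φ a p w)
    (hpq : Near φ a p q) (hw : w.1 ∉ X.ambiguous a.1 p.1 q.1) : Compatible φ w q := by
  -- Lift `q.1` along `a`, `w`; non-ambiguity makes the lift compatible with `p`, and linkedness
  -- then identifies it with `q`.
  obtain ⟨δ', h1, h2⟩ := h.exists_compatible hpw.right q.1
  have h3 : Compatible φ p (q.1, δ') := h.compatible_of_notMem_ambiguous (w := w)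
    (q := (q.1, δ')) hw hpw.left h1 (h.compatible_symm hpw.compatible) h2
  obtain rfl : δ' = q.2 := h.eq_of_linked (hpq.symm h hk).linked hpq.left h1 h3
    hpq.right hpq.compatible
  exact h2

include hk' hc hn

/-- A generic `w` near `p` is compatible with both `q` and `r`; as its first point is not ambiguous
for these two, it certifies their compatibility. -/
theorem Near.compatible_of_near {a p q r : Ω × Ω'} (hpq : Near φ a p q) (hpr : Near φ a p r) :
    Compatible φ q r := by
  obtain ⟨ω, hω, hL, hT⟩ := exists_generic hk' hc hn a.1 {p.1}
    {(p.1, q.1), (p.1, r.1), (q.1, r.1)}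
    ((Nat.add_le_add (Finset.card_singleton _).le Finset.card_le_three).trans (by norm_num))
  simp only [Finset.mem_insert, Finset.mem_singleton, forall_eq_or_imp, forall_eq] at hL hT
  obtain ⟨ω', hpw⟩ := h.exists_near hpq.ne_left hpq.left hω hL
  have hq := compatible_of_near_of_notMem_ambiguous h hk hpw hpq hT.1
  have hr := compatible_of_near_of_notMem_ambiguous h hk hpw hpr hT.2.1
  exact h.compatible_of_notMem_ambiguous hT.2.2 hpq.right hpr.right hq hr

/-- Having a common near neighbour is a transitive relation. -/
theorem exists_near_trans {a p q r x y : Ω × Ω'} (hxp : Near φ a x p) (hxq : Near φ a x q)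
    (hyq : Near φ a y q) (hyr : Near φ a y r) : ∃ w, Near φ a w p ∧ Near φ a w r := by
  obtain ⟨ω, hω, hL, -⟩ := exists_generic hk' hc hn a.1 {p.1, q.1, r.1, x.1, y.1} ∅
    ((Nat.add_le_add Finset.card_le_five le_rfl).trans (by norm_num))
  simp only [Finset.mem_insert, Finset.mem_singleton, forall_eq_or_imp, forall_eq] at hL
  obtain ⟨ω', hqw⟩ := h.exists_near hxq.ne_right hxq.right hω hL.2.1
  -- Compatibility with the lift of `ω` spreads from `q` to `z` (both it and `z` are near `q`), then
  -- from `z` to `s`.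
  have key : ∀ {z s : Ω × Ω'}, Near φ a z q → Near φ a z s →
      X.Linked (X.rel a.1 z.1) (X.rel a.1 ω) → X.Linked (X.rel a.1 s.1) (X.rel a.1 ω) →
      Near φ a (ω, ω') s := by
    intro z s hzq hzs hlz hls
    have hz : Near φ a z (ω, ω') := ⟨hzq.ne_left, hω, hzq.left, hqw.right, hlz,
      Near.compatible_of_near h hk hk' hc hn (hzq.symm h hk) hqw⟩
    have hs : Near φ a s (ω, ω') := ⟨hzs.ne_right, hω, hzs.right, hqw.right, hls,
      Near.compatible_of_near h hk hk' hc hn hzs hz⟩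
    exact hs.symm h hk
  exact ⟨_, key hxq hxp hL.2.2.2.1 hL.1, key hyq hyr hL.2.2.2.2 hL.2.2.1⟩

theorem exists_common_near {a p : Ω × Ω'} (hp : a.1 ≠ p.1) (hap : Compatible φ a p) {γ : Ω}
    (hγ : a.1 ≠ γ) : ∃ γ' x, Near φ a x p ∧ Near φ a x (γ, γ') := by
  obtain ⟨ω, hω, hL, -⟩ := exists_generic hk' hc hn a.1 {p.1, γ} ∅
    ((Nat.add_le_add Finset.card_le_two le_rfl).trans (by norm_num))
  simp only [Finset.mem_insert, Finset.mem_singleton, forall_eq_or_imp, forall_eq] at hL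
  obtain ⟨ω', hpw⟩ := h.exists_near hp hap hω hL.1
  have hl : X.Linked (X.rel a.1 ω) (X.rel a.1 γ) := hL.2.symm (by
    rw [hk _ (X.rel_eq_diag.not.2 hγ), hk _ (X.rel_eq_diag.not.2 hω)])
  obtain ⟨γ', hγ'⟩ := h.exists_near (p := (ω, ω')) hω hpw.right hγ hl
  exact ⟨γ', _, hpw.symm h hk, hγ'⟩

/-- Any compatible assignment of two distinct points extends to an isomorphism. -/
theorem exists_induces {a b : Ω × Ω'} (hne : a.1 ≠ b.1) (hab : Compatible φ a b) :
    ∃ f : Ω ≃ Ω', X.Induces X' f φ ∧ f a.1 = a.2 ∧ f b.1 = b.2 := by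
  -- The image of `γ` is any lift sharing a near neighbour with `b`. Its uniqueness is not needed,
  -- since all such lifts turn out to be pairwise compatible.
  have hex : ∀ γ, ∃ γ', (a.1 = γ ∧ a.2 = γ') ∨
      (a.1 ≠ γ ∧ ∃ x, Near φ a x b ∧ Near φ a x (γ, γ')) := by
    intro γ
    by_cases hγ : a.1 = γ
    · exact ⟨a.2, Or.inl ⟨hγ, rfl⟩⟩
    · obtain ⟨γ', hγ'⟩ := exists_common_near h hk hk' hc hn hne hab hγ
      exact ⟨γ', Or.inr ⟨hγ, hγ'⟩⟩
  choose f hf using hex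
  have ha : f a.1 = a.2 := by
    rcases hf a.1 with h1 | h1
    · exact h1.2.symm
    · exact absurd rfl h1.1
  have haf : ∀ γ, Compatible φ a (γ, f γ) := by
    intro γ
    rcases hf γ with ⟨h1, -⟩ | ⟨-, x, -, hx⟩
    · subst h1
      rw [ha]
      exact h.compatible_self a
    · exact hx.right
  have hcomp : ∀ γ δ, Compatible φ (γ, f γ) (δ, f δ) := by
    intro γ δ
    rcases hf γ with ⟨h1, -⟩ | ⟨-, x, hxb, hx⟩
    · subst h1
      rw [ha]
      exact haf δ
    rcases hf δ with ⟨h1, -⟩ | ⟨-, y, hyb, hy⟩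
    · subst h1
      rw [ha]
      exact h.compatible_symm (haf γ)
    obtain ⟨w, hw1, hw2⟩ := exists_near_trans h hk hk' hc hn hx hxb hyb hy
    exact Near.compatible_of_near h hk hk' hc hn hw1 hw2
  have hb : f b.1 = b.2 := by
    rcases hf b.1 with ⟨h1, -⟩ | ⟨-, x, hxb, hx⟩
    · exact absurd h1 hne
    · exact (h.fst_eq_iff (Near.compatible_of_near h hk hk' hc hn hx hxb)).1 rfl
  have hinj : Function.Injective f := fun γ δ hγδ => (h.fst_eq_iff (hcomp γ δ)).2 hγδ
  have hbij : Function.Bijective f := (Fintype.bijective_iff_injective_and_card f).2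
    ⟨hinj, h.card_eq⟩
  refine ⟨Equiv.ofBijective f hbij, fun s => ?_, ha, hb⟩
  ext ⟨γ', δ'⟩
  constructor
  · rintro ⟨⟨γ, δ⟩, hs, he⟩
    obtain ⟨rfl, rfl⟩ := Prod.ext_iff.1 he
    rw [← X.rel_eq_iff] at hs
    exact X'.rel_eq_iff.1 ((hcomp γ δ).trans (by rw [← hs]))
  · intro hs
    obtain ⟨γ, rfl⟩ := hbij.2 γ'
    obtain ⟨δ, rfl⟩ := hbij.2 δ'
    rw [← X'.rel_eq_iff] at hs
    exact ⟨(γ, δ), X.rel_eq_iff.1 (φ.injective ((hcomp γ δ).symm.trans hs)), rfl⟩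

-- The group is that of all permutations preserving every basis relation; extension with the
-- identity as φ supplies enough of them.
omit h in
theorem isSchurian_of_indistinguishing : X.IsSchurian := by
  have hid : X.IsAlgebraicIso X (Equiv.refl _) := fun _ _ _ => rfl
  let K : Subgroup (Equiv.Perm Ω) :=
    { carrier := {g | ∀ α β, X.rel (g α) (g β) = X.rel α β}
      mul_mem' := fun {g g'} hg hg' α β => by
        rw [Equiv.Perm.mul_apply, Equiv.Perm.mul_apply, hg, hg']
      one_mem' := fun _ _ => rfl
      inv_mem' := fun {g} hg α β => by
        simpa using (hg (g⁻¹ α) (g⁻¹ β)).symm }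
  have hK : ∀ {α β α' β' : Ω}, α ≠ β → X.rel α' β' = X.rel α β →
      ∃ g : K, g • α = α' ∧ g • β = β' := by
    intro α β α' β' hne he
    obtain ⟨f, hf, h1, h2⟩ := exists_induces (a := (α, α')) (b := (β, β')) hid hk hk' hc hn hne he
    refine ⟨⟨f, fun γ δ => ?_⟩, h1, h2⟩
    rw [X.rel_eq_iff]
    have := hf (X.rel γ δ)
    rw [Equiv.refl_apply] at this
    rw [← this]
    exact ⟨(γ, δ), X.mem_rel γ δ, rfl⟩
  have hcard : 1 < Fintype.card Ω := lt_of_le_of_lt (Nat.le_add_right _ _) hn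
  have htrans : ∀ α α' : Ω, ∃ g : K, g • α = α' := by
    intro α α'
    have : Nontrivial Ω := Fintype.one_lt_card_iff_nontrivial.1 hcard
    obtain ⟨β, hβ⟩ := exists_ne α
    obtain ⟨β', hβ'⟩ := X.exists_rel_eq_left (X.rel α β) α'
    obtain ⟨g, hg, -⟩ := hK hβ.symm hβ'
    exact ⟨g, hg⟩
  have horb : ∀ p : Ω × Ω, MulAction.orbit K p = (X.rel p.1 p.2 : Set (Ω × Ω)) := by
    rintro ⟨α, β⟩
    ext ⟨α', β'⟩
    rw [← X.rel_eq_iff]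
    constructor
    · rintro ⟨g, hg⟩
      obtain ⟨rfl, rfl⟩ := Prod.ext_iff.1 hg
      exact g.2 α β
    · intro he
      -- Extension needs two distinct points, so the diagonal is covered by transitivity.
      by_cases hne : α = β
      · obtain rfl := hne
        rw [X.rel_self, X.rel_eq_diag] at he
        obtain rfl := he
        obtain ⟨g, hg⟩ := htrans α α'
        exact ⟨g, Prod.ext hg hg⟩
      · obtain ⟨g, h1, h2⟩ := hK hne he
        exact ⟨g, Prod.ext h1 h2⟩
  refine ⟨K, ⟨htrans⟩, ?_⟩
  ext s
  simp only [horb, Set.mem_range]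
  constructor
  · intro hs
    obtain ⟨α, β, h1⟩ := X.exists_rel_eq ⟨s, hs⟩
    exact ⟨(α, β), congrArg Subtype.val h1⟩
  · rintro ⟨p, rfl⟩
    exact (X.rel p.1 p.2).2

omit h in
theorem isSeparable_of_indistinguishing : IsSeparable.{u, v} X := by
  intro Ω' _ X' φ h
  have hcard : 1 < Fintype.card Ω := lt_of_le_of_lt (Nat.le_add_right _ _) hn
  obtain ⟨α, β, hne⟩ := Fintype.one_lt_card_iff.1 hcard
  obtain ⟨α', β', he⟩ := X'.exists_rel_eq (φ (X.rel α β))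
  obtain ⟨f, hf, -⟩ := exists_induces (a := (α, α')) (b := (β, β')) h hk hk' hc hn hne he
  exact ⟨f, hf⟩

end Extension

end AssociationScheme

/-! ### Characters and multiplicities of semisimple modules. -/

section SemisimpleTrace

open scoped Classical

variable (A : Type*) [Ring A] [Algebra ℂ A]

/-- The character of the module `M`. -/
noncomputable def moduleCharacter (M : Type*) [AddCommGroup M] [Module ℂ M] [Module A M]
    [IsScalarTower ℂ A M] (a : A) : ℂ :=
  LinearMap.trace ℂ M (Algebra.lsmul ℂ ℂ M a)

variable {A}
variable {M : Type*} [AddCommGroup M] [Module ℂ M] [Module A M] [IsScalarTower ℂ A M]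
variable {N : Type*} [AddCommGroup N] [Module ℂ N] [Module A N] [IsScalarTower ℂ A N]

theorem moduleCharacter_congr (e : M ≃ₗ[A] N) (a : A) :
    moduleCharacter A M a = moduleCharacter A N a := by
  rw [moduleCharacter, moduleCharacter, ← LinearMap.trace_conj' _ (e.restrictScalars ℂ)]
  congr 1
  ext x
  simp [LinearEquiv.conj_apply]

theorem moduleCharacter_of_smul_eq [FiniteDimensional ℂ M] {a : A} {c : ℂ} (h : ∀ x : M, a • x = c • x) :
    moduleCharacter A M a = c * Module.finrank ℂ M := by
  have : Algebra.lsmul ℂ ℂ M a = c • LinearMap.id := by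
    ext x
    simp [h]
  rw [moduleCharacter, this, map_smul, LinearMap.trace_id, smul_eq_mul]

instance Submodule.finiteDimensional_of_algebra [FiniteDimensional ℂ M] (S : Submodule A M) :
    FiniteDimensional ℂ S :=
  inferInstanceAs (FiniteDimensional ℂ (S.restrictScalars ℂ))

theorem moduleCharacter_eq_sum [FiniteDimensional ℂ M] {ι : Type*} [Fintype ι] [DecidableEq ι]
    {S : ι → Submodule A M} (h : DirectSum.IsInternal S) (a : A) :
    moduleCharacter A M a = ∑ i, moduleCharacter A (S i) a := by
  have h' : DirectSum.IsInternal fun i => (S i).restrictScalars ℂ := h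
  exact LinearMap.trace_eq_sum_trace_restrict h' (f := Algebra.lsmul ℂ ℂ M a)
    fun i x hx => (S i).smul_mem a hx

theorem exists_isInternal_simple (A M : Type*) [Ring A] [AddCommGroup M] [Module A M]
    [IsSemisimpleModule A M] [Module.Finite A M] :
    ∃ (n : ℕ) (S : Fin n → Submodule A M), DirectSum.IsInternal S ∧
      ∀ i, IsSimpleModule A (S i) := by
  have ⟨s, ind, hsup, simple⟩ := IsSemisimpleModule.exists_sSupIndep_sSup_simples_eq_top A M
  have ind' := (sSupIndep_iff _).1 ind
  have : Finite s := WellFoundedGT.finite_of_iSupIndep ind' fun S =>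
    have := simple S S.2
    (S.1.nontrivial_iff_ne_bot).mp <| IsSimpleModule.nontrivial A S
  refine ⟨_, fun i => ((Finite.equivFin s).symm i).1, ?_, fun i => simple _ (Subtype.coe_prop _)⟩
  rw [DirectSum.isInternal_submodule_iff_iSupIndep_and_iSup_eq_top]
  refine ⟨ind'.comp (Finite.equivFin s).symm.injective, ?_⟩
  rw [(Finite.equivFin s).symm.iSup_comp (g := fun t : s => t.1), ← sSup_eq_iSup', hsup]

/-- Schur's lemma over an algebraically closed field. -/
theorem finrank_hom_simple [FiniteDimensional ℂ M] [FiniteDimensional ℂ N]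
    [IsSimpleModule A M] [IsSimpleModule A N] :
    Module.finrank ℂ (M →ₗ[A] N) = if Nonempty (M ≃ₗ[A] N) then 1 else 0 := by
  split_ifs with h
  · obtain ⟨e⟩ := h
    have := IsSimpleModule.nontrivial A M
    have h0 : e.toLinearMap ≠ 0 := by
      intro h0
      obtain ⟨x, hx⟩ := exists_ne (0 : M)
      exact hx (e.map_eq_zero_iff.1 (LinearMap.congr_fun h0 x))
    refine (finrank_eq_one_iff_of_nonzero' _ h0).2 fun f => ?_
    obtain ⟨c, hc⟩ := (IsSimpleModule.algebraMap_end_bijective_of_isAlgClosed ℂ).2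
      (e.symm.toLinearMap.comp f)
    refine ⟨c, ?_⟩
    ext x
    have := LinearMap.congr_fun hc x
    simp only [Module.algebraMap_end_apply, LinearMap.comp_apply, LinearEquiv.coe_coe] at this
    rw [LinearMap.smul_apply, LinearEquiv.coe_coe, ← e.apply_symm_apply (f x), ← this,
      ← LinearEquiv.coe_coe, LinearMap.map_smul_of_tower]
  · have : Subsingleton (M →ₗ[A] N) := by
      refine subsingleton_of_forall_eq 0 fun f => ?_
      exact f.bijective_or_eq_zero.resolve_left fun hf => h ⟨LinearEquiv.ofBijective f hf⟩
    exact Module.finrank_zero_of_subsingleton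

variable {ι : Type*} [Fintype ι] [DecidableEq ι] {S : ι → Submodule A M}

instance finiteDimensional_hom [FiniteDimensional ℂ M] [FiniteDimensional ℂ N] :
    FiniteDimensional ℂ (M →ₗ[A] N) :=
  Module.Finite.of_injective (LinearMap.restrictScalarsₗ ℂ A M N ℂ)
    (LinearMap.restrictScalars_injective ℂ)

theorem finrank_hom_of_isInternal_left [FiniteDimensional ℂ M] [FiniteDimensional ℂ N]
    [IsSimpleModule A N] (h : DirectSum.IsInternal S) (hs : ∀ i, IsSimpleModule A (S i)) :
    Module.finrank ℂ (M →ₗ[A] N) =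
      (Finset.univ.filter fun i => Nonempty (S i ≃ₗ[A] N)).card := by
  let e : (DirectSum ι fun i => S i) ≃ₗ[A] M :=
    LinearEquiv.ofBijective (DirectSum.coeLinearMap S) h
  let e₁ : (M →ₗ[A] N) ≃ₗ[ℂ] ((DirectSum ι fun i => S i) →ₗ[A] N) :=
    { toFun := fun f => f.comp e.toLinearMap
      invFun := fun f => f.comp e.symm.toLinearMap
      map_add' := fun f g => rfl
      map_smul' := fun c f => rfl
      left_inv := fun f => by ext x; simp
      right_inv := fun f => by
        refine LinearMap.ext fun x => ?_
        simp }
  let e₂ := DFinsupp.lsum (M := fun i => S i) (N := N) (R := A) ℂ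
  rw [(e₁.trans e₂.symm).finrank_eq, Module.finrank_pi_fintype, Finset.card_filter]
  exact Finset.sum_congr rfl fun i _ => finrank_hom_simple

theorem finrank_hom_of_isInternal_right [FiniteDimensional ℂ M] [FiniteDimensional ℂ N]
    [IsSimpleModule A N] (h : DirectSum.IsInternal S) (hs : ∀ i, IsSimpleModule A (S i)) :
    Module.finrank ℂ (N →ₗ[A] M) =
      (Finset.univ.filter fun i => Nonempty (N ≃ₗ[A] S i)).card := by
  let e : M ≃ₗ[A] ((i : ι) → S i) :=
    (LinearEquiv.ofBijective (DirectSum.coeLinearMap S) h).symm.trans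
      (DirectSum.linearEquivFunOnFintype A ι fun i => S i)
  let e₁ : (N →ₗ[A] M) ≃ₗ[ℂ] ((i : ι) → N →ₗ[A] S i) :=
    { toFun := fun f i => (LinearMap.proj i).comp (e.toLinearMap.comp f)
      invFun := fun f => e.symm.toLinearMap.comp (LinearMap.pi f)
      map_add' := fun f g => by ext i x; simp
      map_smul' := fun c f => by
        ext i x
        have := LinearMap.map_smul_of_tower ((LinearMap.proj i).comp e.toLinearMap) c (f x)
        exact congrArg Subtype.val this
      left_inv := fun f => by
        ext x
        exact e.symm_apply_apply (f x)
      right_inv := fun f => by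
        ext i x
        simp }
  rw [e₁.finrank_eq, Module.finrank_pi_fintype, Finset.card_filter]
  exact Finset.sum_congr rfl fun i _ => finrank_hom_simple

/-- In a decomposition of the regular module into simple modules, every simple module occurs as
often as its dimension says. -/
theorem card_equiv_eq_finrank [FiniteDimensional ℂ A] [FiniteDimensional ℂ N]
    [IsSimpleModule A N] {V : ι → Submodule A A} (hV : DirectSum.IsInternal V)
    (hs : ∀ i, IsSimpleModule A (V i)) :
    (Finset.univ.filter fun i => Nonempty (V i ≃ₗ[A] N)).card = Module.finrank ℂ N := by
  -- Both sides are the dimension of Hom(A, N) ≅ N.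
  rw [← finrank_hom_of_isInternal_left hV hs]
  exact (LinearMap.ringLmapEquivSelf A ℂ N).finrank_eq

/-- The character of a semisimple module, in terms of the constituents of the regular module. -/
theorem moduleCharacter_eq_sum_finrank_hom [FiniteDimensional ℂ A] [FiniteDimensional ℂ M]
    [IsSemisimpleModule A M] {V : ι → Submodule A A} (hV : DirectSum.IsInternal V)
    (hs : ∀ i, IsSimpleModule A (V i)) (a : A) :
    moduleCharacter A M a =
      ∑ i, (Module.finrank ℂ (V i →ₗ[A] M) : ℂ) / (Module.finrank ℂ (V i) : ℂ) *
        moduleCharacter A (V i) a := by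
  have : Module.Finite A M := Module.Finite.of_restrictScalars_finite ℂ A M
  obtain ⟨n, W, hW, hWs⟩ := exists_isInternal_simple A M
  have hpos : ∀ i, (Module.finrank ℂ (V i) : ℂ) ≠ 0 := fun i => by
    have := IsSimpleModule.nontrivial A (V i)
    exact_mod_cast Module.finrank_pos.ne'
  -- Exactly dim W_j of the `V i` are isomorphic to W_j, which cancels the denominator.
  have h1 : ∀ j, moduleCharacter A (W j) a = ∑ i, if Nonempty (V i ≃ₗ[A] W j) then
      moduleCharacter A (V i) a / (Module.finrank ℂ (V i) : ℂ) else 0 := by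
    intro j
    have h2 : ∀ i ∈ Finset.univ.filter fun i => Nonempty (V i ≃ₗ[A] W j),
        moduleCharacter A (V i) a / (Module.finrank ℂ (V i) : ℂ) =
          moduleCharacter A (W j) a / (Module.finrank ℂ (W j) : ℂ) := by
      intro i hi
      obtain ⟨e⟩ := (Finset.mem_filter.1 hi).2
      rw [moduleCharacter_congr e, (e.restrictScalars ℂ).finrank_eq]
    have := IsSimpleModule.nontrivial A (W j)
    have h3 : (Module.finrank ℂ (W j) : ℂ) ≠ 0 := by exact_mod_cast Module.finrank_pos.ne'
    rw [← Finset.sum_filter, Finset.sum_congr rfl h2, Finset.sum_const,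
      card_equiv_eq_finrank hV hs, nsmul_eq_mul, mul_div_cancel₀ _ h3]
  rw [moduleCharacter_eq_sum hW, Finset.sum_congr rfl fun j _ => h1 j, Finset.sum_comm]
  refine Finset.sum_congr rfl fun i _ => ?_
  rw [finrank_hom_of_isInternal_right hW hWs, ← Finset.sum_filter, Finset.sum_const,
    nsmul_eq_mul]
  ring

end SemisimpleTrace

namespace AssociationScheme

open scoped Classical

variable {Ω : Type u} [Fintype Ω] (X : AssociationScheme Ω)

/-! ### The adjacency matrices span the adjacency algebra. -/

section AdjacencyAlgebra

theorem adjOp_apply (s : X.rels) (v : Ω → ℂ) (α : Ω) :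
    X.adjOp s v α = ∑ β, if X.rel α β = s then v β else 0 := by
  simp [adjOp, Matrix.mulVec, dotProduct, Set.indicator_apply, rel_eq_iff]

theorem adj_smul_apply (s : X.rels) (v : Ω → ℂ) (α : Ω) :
    (X.adj s • v) α = ∑ β, if X.rel α β = s then v β else 0 :=
  X.adjOp_apply s v α

theorem adj_diag : X.adj X.diag = 1 := by
  refine Subtype.ext (LinearMap.ext fun v => funext fun α => ?_)
  refine (X.adjOp_apply _ v α).trans ?_
  simp [rel_eq_diag]

theorem adj_mul_adj (r s : X.rels) : X.adj r * X.adj s = ∑ t, (X.interNum r s t : ℂ) • X.adj t := by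
  refine Subtype.ext (LinearMap.ext fun v => funext fun α => ?_)
  change X.adjOp r (X.adjOp s v) α = _
  simp only [AddSubmonoidClass.coe_finsetSum, LinearMap.sum_apply, Finset.sum_apply]
  change _ = ∑ t, (X.interNum r s t : ℂ) * X.adjOp t v α
  simp only [adjOp_apply, Finset.mul_sum]
  rw [Finset.sum_comm]
  have h1 : ∀ γ, (if X.rel α γ = r then ∑ β, (if X.rel γ β = s then v β else 0) else 0) =
      ∑ β, if X.rel α γ = r ∧ X.rel γ β = s then v β else 0 := by
    intro γ
    by_cases h : X.rel α γ = r <;> simp [h]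
  simp only [h1]
  rw [Finset.sum_comm]
  refine Finset.sum_congr rfl fun β _ => ?_
  simp only [mul_ite, mul_zero, Finset.sum_ite_eq, Finset.mem_univ, if_true, interNum_rel]
  rw [← Finset.sum_filter, Finset.sum_const, nsmul_eq_mul]

theorem span_adj : Submodule.span ℂ (Set.range X.adj) = ⊤ := by
  rw [eq_top_iff]
  rintro ⟨a, ha⟩ -
  have hmul : ∀ x ∈ Submodule.span ℂ (Set.range X.adj),
      ∀ y ∈ Submodule.span ℂ (Set.range X.adj), x * y ∈ Submodule.span ℂ (Set.range X.adj) := by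
    intro x hx y hy
    have h := Submodule.mul_mem_mul hx hy
    rw [Submodule.span_mul_span] at h
    refine Submodule.span_le.2 ?_ h
    rintro _ ⟨_, ⟨r, rfl⟩, _, ⟨s, rfl⟩, rfl⟩
    change X.adj r * X.adj s ∈ _
    rw [adj_mul_adj]
    exact Submodule.sum_mem _ fun t _ =>
      Submodule.smul_mem _ _ (Submodule.subset_span (Set.mem_range_self t))
  induction ha using Algebra.adjoin_induction with
  | mem x hx =>
    obtain ⟨s, rfl⟩ := hx
    exact Submodule.subset_span ⟨s, rfl⟩
  | algebraMap c =>
    have h : (⟨algebraMap ℂ _ c, Subalgebra.algebraMap_mem _ c⟩ : X.adjAlgebra) =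
        c • X.adj X.diag := by
      rw [adj_diag, ← Algebra.algebraMap_eq_smul_one]
      rfl
    exact h ▸ Submodule.smul_mem _ _ (Submodule.subset_span ⟨_, rfl⟩)
  | add x y hx hy h1 h2 => exact Submodule.add_mem _ h1 h2
  | mul x y hx hy h1 h2 => exact hmul _ h1 _ h2

end AdjacencyAlgebra

/-! ### Semisimplicity, principal module and character identities. -/

section AdjacencyAction

/-- A description of the adjacency algebra as an abstract algebra `A` acting on the standard
module: an algebra spanned by elements that act and multiply as the adjacency matrices. -/
structure AdjacencyAction (X : AssociationScheme Ω) (A : Type*) [Ring A] [Algebra ℂ A]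
    [Module A (Ω → ℂ)] where
  /-- the elements acting as adjacency matrices -/
  op : X.rels → A
  span_op : Submodule.span ℂ (Set.range op) = ⊤
  op_smul_apply : ∀ (s : X.rels) (v : Ω → ℂ) (α : Ω),
    (op s • v) α = ∑ β, if X.rel α β = s then v β else 0
  op_diag : op X.diag = 1
  op_mul_op : ∀ r s, op r * op s = ∑ t, (X.interNum r s t : ℂ) • op t

variable {X} {A : Type u} [Ring A] [Algebra ℂ A] [Module A (Ω → ℂ)] [IsScalarTower ℂ A (Ω → ℂ)]

namespace AdjacencyAction

variable (D : AdjacencyAction X A)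
include D

theorem sum_smul_op_smul_single (c : X.rels → ℂ) (α β : Ω) :
    ((∑ s, c s • D.op s) • (Pi.single β 1 : Ω → ℂ)) α = c (X.rel α β) := by
  simp only [Finset.sum_smul, Finset.sum_apply, smul_assoc, Pi.smul_apply, D.op_smul_apply,
    smul_eq_mul]
  have h : ∀ s, (∑ γ, if X.rel α γ = s then (Pi.single β 1 : Ω → ℂ) γ else 0) =
      if X.rel α β = s then 1 else 0 := by
    intro s
    rw [Finset.sum_eq_single β (fun γ _ hγ => by simp [hγ]) (by simp), Pi.single_eq_same]
  simp [h]

theorem linearIndependent_op : LinearIndependent ℂ D.op := by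
  refine Fintype.linearIndependent_iff.2 fun c hc s => ?_
  obtain ⟨α, β, rfl⟩ := X.exists_rel_eq s
  rw [← D.sum_smul_op_smul_single c α β, hc, zero_smul, Pi.zero_apply]

/-- The adjacency matrices form a basis of the adjacency algebra. -/
noncomputable def basis : Module.Basis X.rels ℂ A :=
  Module.Basis.mk D.linearIndependent_op D.span_op.ge

theorem basis_apply (s : X.rels) : D.basis s = D.op s := by
  simp [basis]

theorem finiteDimensional : FiniteDimensional ℂ A := D.basis.finiteDimensional_of_finite

/-- The character of the regular module. -/
theorem moduleCharacter_regular (s : X.rels) :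
    moduleCharacter A A (D.op s) = ∑ t, (X.interNum s t t : ℂ) := by
  rw [moduleCharacter, LinearMap.trace_eq_matrix_trace ℂ D.basis, Matrix.trace]
  refine Finset.sum_congr rfl fun t _ => ?_
  rw [Matrix.diag_apply, LinearMap.toMatrix_apply, D.basis_apply]
  change D.basis.repr (D.op s * D.op t) t = _
  rw [D.op_mul_op]
  simp only [← D.basis_apply]
  rw [Module.Basis.repr_sum_self]

/-- The character of the standard module. -/
theorem moduleCharacter_standard (s : X.rels) :
    moduleCharacter A (Ω → ℂ) (D.op s) =
      if s = X.diag then (Fintype.card Ω : ℂ) else 0 := by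
  rw [moduleCharacter, LinearMap.trace_eq_matrix_trace ℂ (Pi.basisFun ℂ Ω), Matrix.trace]
  have h : ∀ α : Ω, Matrix.diag (LinearMap.toMatrix (Pi.basisFun ℂ Ω) (Pi.basisFun ℂ Ω)
      (Algebra.lsmul ℂ ℂ (Ω → ℂ) (D.op s))) α = if s = X.diag then 1 else 0 := by
    intro α
    rw [Matrix.diag_apply, LinearMap.toMatrix_apply, Pi.basisFun_apply, Pi.basisFun_repr]
    refine (D.op_smul_apply s _ α).trans ?_
    rw [Finset.sum_eq_single α (fun β _ h => by simp [h]) (by simp), X.rel_self]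
    simp [eq_comm]
  simp only [h]
  split_ifs <;> simp

/-- The adjoint of A_s is A_{s*}, and adjoints extend conjugate-linearly to the span. -/
theorem exists_adjoint (a : A) :
    ∃ b : A, ∀ v w : Ω → ℂ, (a • v) ⬝ᵥ Star.star w = v ⬝ᵥ Star.star (b • w) := by
  have ha : a ∈ Submodule.span ℂ (Set.range D.op) := D.span_op ▸ Submodule.mem_top
  induction ha using Submodule.span_induction with
  | mem x hx =>
    obtain ⟨s, rfl⟩ := hx
    refine ⟨D.op (X.star s), fun v w => ?_⟩
    simp only [dotProduct, D.op_smul_apply, Pi.star_apply, star_sum, Finset.sum_mul,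
      Finset.mul_sum]
    rw [Finset.sum_comm]
    refine Finset.sum_congr rfl fun β _ => Finset.sum_congr rfl fun α _ => ?_
    have h : X.rel β α = X.star s ↔ X.rel α β = s := by
      rw [← X.star_rel α β]
      exact ⟨fun h => by simpa [X.star_star] using congrArg X.star h, fun h => by rw [h]⟩
    by_cases hs : X.rel α β = s <;> simp [h, hs]
  | zero => exact ⟨0, fun v w => by simp⟩
  | add x y hx hy h1 h2 =>
    obtain ⟨x', h1⟩ := h1
    obtain ⟨y', h2⟩ := h2
    exact ⟨x' + y', fun v w => by simp [add_smul, add_dotProduct, dotProduct_add, h1, h2]⟩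
  | smul c x hx h1 =>
    obtain ⟨x', h1⟩ := h1
    exact ⟨Star.star c • x', fun v w => by
      simp [smul_assoc, smul_dotProduct, dotProduct_smul, star_smul, h1]⟩

/-- By closure under adjoints, the Hermitian orthogonal complement of a submodule is a submodule. -/
theorem isSemisimpleModule_standard : IsSemisimpleModule A (Ω → ℂ) := by
  rw [isSemisimpleModule_iff]
  refine ⟨fun W => ?_⟩
  let U : Submodule A (Ω → ℂ) :=
    { carrier := {v | ∀ w ∈ W, v ⬝ᵥ Star.star w = 0}
      add_mem' := fun {v v'} hv hv' w hw => by rw [add_dotProduct, hv w hw, hv' w hw, add_zero]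
      zero_mem' := fun w _ => zero_dotProduct _
      smul_mem' := fun a v hv w hw => by
        obtain ⟨b, h⟩ := D.exists_adjoint a
        exact (h v w).trans (hv _ (W.smul_mem b hw)) }
  refine ⟨U, ?_, ?_⟩
  · rw [Submodule.disjoint_def]
    intro v hv hU
    have h : WithLp.ofLp (WithLp.toLp 2 v) ⬝ᵥ Star.star (WithLp.ofLp (WithLp.toLp 2 v)) = 0 :=
      hU v hv
    rwa [← EuclideanSpace.inner_eq_star_dotProduct, inner_self_eq_zero,
      WithLp.toLp_eq_zero] at h
  · rw [codisjoint_iff, eq_top_iff]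
    intro v _
    let e := WithLp.linearEquiv 2 ℂ (Ω → ℂ)
    let W' : Submodule ℂ (EuclideanSpace ℂ Ω) :=
      (W.restrictScalars ℂ).comap e.toLinearMap
    obtain ⟨y, hy, z, hz, hyz⟩ := W'.exists_add_mem_mem_orthogonal (e.symm v)
    refine Submodule.mem_sup.2 ⟨e y, hy, e z, fun w hw => ?_, ?_⟩
    · have := (Submodule.mem_orthogonal _ _).1 hz (e.symm w) (by simpa [W'] using hw)
      rwa [EuclideanSpace.inner_eq_star_dotProduct] at this
    · rw [← map_add, ← hyz, e.apply_symm_apply]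

/-- The standard module is faithful, so a ↦ (a e_α)_α embeds the regular module into a power of it.
-/
theorem isSemisimpleRing : IsSemisimpleRing A := by
  let f : A →ₗ[A] (Ω → Ω → ℂ) :=
    LinearMap.pi fun α => LinearMap.toSpanSingleton A (Ω → ℂ) (Pi.single α 1)
  have := D.isSemisimpleModule_standard
  refine IsSemisimpleModule.of_injective f ((injective_iff_map_eq_zero f).2 fun a ha => ?_)
  rw [← D.basis.sum_repr a]
  refine Finset.sum_eq_zero fun s _ => ?_
  obtain ⟨α, β, rfl⟩ := X.exists_rel_eq s
  have h := D.sum_smul_op_smul_single (D.basis.repr a) α β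
  simp only [← D.basis_apply, D.basis.sum_repr] at h
  rw [← h, show a • (Pi.single β 1 : Ω → ℂ) = 0 from congrFun ha β, Pi.zero_apply, zero_smul]

variable {V : Type u} [AddCommGroup V] [Module ℂ V] [Module A V] [IsScalarTower ℂ A V]

/-- The module `V` affords the principal character. -/
def IsPrincipal (V : Type u) [AddCommGroup V] [Module ℂ V] [Module A V] : Prop :=
  ∀ (s : X.rels) (x : V), D.op s • x = (X.valency s : ℂ) • x

/-- The principal character. -/
noncomputable def principalCharacter : A →ₗ[ℂ] ℂ :=
  D.basis.constr ℂ fun s => (X.valency s : ℂ)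

theorem principalCharacter_op (s : X.rels) : D.principalCharacter (D.op s) = X.valency s := by
  rw [principalCharacter, ← D.basis_apply, Module.Basis.constr_basis]

variable {D} in
theorem IsPrincipal.smul_eq (h : D.IsPrincipal V) (a : A) (x : V) :
    a • x = D.principalCharacter a • x := by
  have key : (LinearMap.toSpanSingleton A V x).restrictScalars ℂ =
      D.principalCharacter.smulRight x := by
    refine D.basis.ext fun s => ?_
    simp [D.basis_apply, D.principalCharacter_op, h s x]
  exact LinearMap.congr_fun key a

variable {D} in
theorem IsPrincipal.finrank_eq_one [IsSimpleModule A V] (h : D.IsPrincipal V) :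
    Module.finrank ℂ V = 1 := by
  have := IsSimpleModule.nontrivial A V
  obtain ⟨x, hx⟩ := exists_ne (0 : V)
  refine (finrank_eq_one_iff_of_nonzero' x hx).2 fun y => ?_
  obtain ⟨a, rfl⟩ := IsSimpleModule.toSpanSingleton_surjective A hx y
  exact ⟨D.principalCharacter a, (h.smul_eq a x).symm⟩

omit [IsScalarTower ℂ A (Ω → ℂ)] in
theorem op_smul_const (s : X.rels) (c : ℂ) :
    D.op s • (fun _ => c : Ω → ℂ) = (X.valency s : ℂ) • fun _ => c := by
  ext α
  rw [D.op_smul_apply, ← Finset.sum_filter, Finset.sum_const, ← X.valency_eq_card, nsmul_eq_mul]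
  rfl

/-- The constant functions form a submodule of the standard module. -/
noncomputable def constants : Submodule A (Ω → ℂ) where
  carrier := Set.range fun (c : ℂ) (_ : Ω) => c
  add_mem' := by
    rintro _ _ ⟨c, rfl⟩ ⟨d, rfl⟩
    exact ⟨c + d, rfl⟩
  zero_mem' := ⟨0, rfl⟩
  smul_mem' := by
    rintro a _ ⟨c, rfl⟩
    have key : (LinearMap.toSpanSingleton A (Ω → ℂ) fun _ => c).restrictScalars ℂ =
        D.principalCharacter.smulRight fun _ => c := by
      refine D.basis.ext fun s => ?_
      simp [D.basis_apply, D.principalCharacter_op, D.op_smul_const]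
    exact ⟨D.principalCharacter a * c, (LinearMap.congr_fun key a).symm⟩

theorem isPrincipal_constants : D.IsPrincipal D.constants := by
  rintro s ⟨_, c, rfl⟩
  exact Subtype.ext (D.op_smul_const s c)

/-- The constant function `1`. -/
noncomputable def constantOne : D.constants := ⟨fun _ => 1, 1, rfl⟩

theorem eq_smul_constantOne (x : D.constants) : ∃ c : ℂ, x = c • D.constantOne := by
  obtain ⟨_, c, rfl⟩ := x
  refine ⟨c, Subtype.ext ?_⟩
  ext α
  exact (mul_one c).symm

theorem constantOne_ne_zero : D.constantOne ≠ 0 := by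
  intro h
  obtain ⟨α, -, -⟩ := X.exists_rel_eq X.diag
  exact one_ne_zero (congrFun (congrArg Subtype.val h) α)

instance isSimpleModule_constants : IsSimpleModule A D.constants := by
  rw [isSimpleModule_iff_toSpanSingleton_surjective]
  refine ⟨⟨D.constantOne, 0, D.constantOne_ne_zero⟩, fun x hx y => ?_⟩
  obtain ⟨c, rfl⟩ := D.eq_smul_constantOne x
  obtain ⟨d, rfl⟩ := D.eq_smul_constantOne y
  have hc : c ≠ 0 := by
    rintro rfl
    exact hx (zero_smul _ _)
  refine ⟨algebraMap ℂ _ (d / c), ?_⟩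
  rw [LinearMap.toSpanSingleton_apply, algebraMap_smul, smul_smul, div_mul_cancel₀ _ hc]

variable {D} in
theorem IsPrincipal.nonempty_equiv_constants [IsSimpleModule A V]
    (h : D.IsPrincipal V) : Nonempty (V ≃ₗ[A] D.constants) := by
  have h1 := h.finrank_eq_one
  have h2 := D.isPrincipal_constants.finrank_eq_one
  have : FiniteDimensional ℂ V := Module.finite_of_finrank_pos (by omega)
  let e := LinearEquiv.ofFinrankEq V D.constants (h1.trans h2.symm)
  refine ⟨{ e with map_smul' := fun a x => ?_ }⟩
  change e (a • x) = a • e x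
  rw [h.smul_eq, D.isPrincipal_constants.smul_eq, map_smul]

theorem isPrincipal_iff_nonempty_equiv [IsSimpleModule A V] :
    D.IsPrincipal V ↔ Nonempty (V ≃ₗ[A] D.constants) := by
  refine ⟨fun h => h.nonempty_equiv_constants, fun ⟨e⟩ s x => e.injective ?_⟩
  rw [map_smul, D.isPrincipal_constants s, ← LinearEquiv.coe_coe, LinearMap.map_smul_of_tower]

-- Summing over all s gives Jv = nv for the all-ones matrix J, so every entry of v is the mean.
omit [IsScalarTower ℂ A (Ω → ℂ)] in
theorem exists_eq_const_of_op_smul {v : Ω → ℂ} (h : ∀ s, D.op s • v = (X.valency s : ℂ) • v) :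
    ∃ c : ℂ, v = fun _ => c := by
  have h1 : ∀ α, ∑ β, v β = (Fintype.card Ω : ℂ) * v α := by
    intro α
    have h2 := congrArg (fun w : Ω → ℂ => w α) (Finset.sum_congr rfl fun s _ => h s :
      ∑ s, D.op s • v = ∑ s, (X.valency s : ℂ) • v)
    simp only [Finset.sum_apply, D.op_smul_apply, Pi.smul_apply, smul_eq_mul] at h2
    rw [Finset.sum_comm, ← Finset.sum_mul] at h2
    rw [← X.sum_valency, Nat.cast_sum, ← h2]
    simp
  refine ⟨(∑ β, v β) / Fintype.card Ω, funext fun α => ?_⟩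
  have : Nonempty Ω := ⟨α⟩
  rw [h1 α, mul_div_cancel_left₀]
  exact_mod_cast Fintype.card_ne_zero

theorem finrank_hom_constants :
    Module.finrank ℂ (D.constants →ₗ[A] (Ω → ℂ)) = 1 := by
  refine (finrank_eq_one_iff_of_nonzero' D.constants.subtype fun h => ?_).2 fun f => ?_
  · exact D.constantOne_ne_zero (Subtype.ext (LinearMap.congr_fun h D.constantOne))
  · obtain ⟨c, hc⟩ := D.exists_eq_const_of_op_smul (v := f D.constantOne) fun s => by
      rw [← map_smul, D.isPrincipal_constants s, LinearMap.map_smul_of_tower]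
    refine ⟨c, LinearMap.ext fun x => ?_⟩
    obtain ⟨d, rfl⟩ := D.eq_smul_constantOne x
    rw [LinearMap.map_smul_of_tower, LinearMap.map_smul_of_tower, hc]
    ext α
    simp [constantOne]

variable {D} in
theorem IsPrincipal.finrank_hom_eq_one [IsSimpleModule A V] (h : D.IsPrincipal V) :
    Module.finrank ℂ (V →ₗ[A] (Ω → ℂ)) = 1 := by
  obtain ⟨e⟩ := h.nonempty_equiv_constants
  let e₁ : (V →ₗ[A] (Ω → ℂ)) ≃ₗ[ℂ] (D.constants →ₗ[A] (Ω → ℂ)) :=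
    { toFun := fun f => f.comp e.symm.toLinearMap
      invFun := fun f => f.comp e.toLinearMap
      map_add' := fun f g => rfl
      map_smul' := fun c f => rfl
      left_inv := fun f => by ext x; simp
      right_inv := fun f => by ext x; simp }
  rw [e₁.finrank_eq, D.finrank_hom_constants]

/-- If the ratio of multiplicity and degree is constant on the nonprincipal irreducible characters,
then the character of the standard module is a combination of the regular and the principal
characters. -/
theorem moduleCharacter_standard_eq {c : ℚ}
    (hc : ∀ (V : Type u) [AddCommGroup V] [Module ℂ V] [Module A V] [IsScalarTower ℂ A V],
      IsSimpleModule A V → ¬ D.IsPrincipal V →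
        (Module.finrank ℂ (V →ₗ[A] (Ω → ℂ)) : ℚ) / (Module.finrank ℂ V : ℚ) = c) (s : X.rels) :
    moduleCharacter A (Ω → ℂ) (D.op s) =
      c * (moduleCharacter A A (D.op s) - X.valency s) + X.valency s := by
  have := D.finiteDimensional
  have := D.isSemisimpleModule_standard
  have : IsSemisimpleModule A A := D.isSemisimpleRing
  obtain ⟨n, V, hV, hs⟩ := exists_isInternal_simple A A
  have hcard := card_equiv_eq_finrank (N := D.constants) hV hs
  simp only [← D.isPrincipal_iff_nonempty_equiv] at hcard
  rw [D.isPrincipal_constants.finrank_eq_one] at hcard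
  have hchar : ∀ i, D.IsPrincipal (V i) →
      moduleCharacter A (V i) (D.op s) = X.valency s := by
    intro i hi
    rw [moduleCharacter_of_smul_eq (hi s), hi.finrank_eq_one, Nat.cast_one, mul_one]
  -- The coefficient is c except at the single principal constituent, where it is 1.
  have hterm : ∀ i, (Module.finrank ℂ (V i →ₗ[A] (Ω → ℂ)) : ℂ) /
      (Module.finrank ℂ (V i) : ℂ) * moduleCharacter A (V i) (D.op s) =
      c * moduleCharacter A (V i) (D.op s) +
        if D.IsPrincipal (V i) then (X.valency s : ℂ) - c * X.valency s else 0 := by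
    intro i
    split_ifs with hi
    · have := hi.finrank_hom_eq_one
      rw [this, hi.finrank_eq_one, hchar i hi]
      ring
    · have := congrArg (fun q : ℚ => (q : ℂ)) (hc (V i) (hs i) hi)
      simp only [Rat.cast_div, Rat.cast_natCast] at this
      rw [this, add_zero]
  rw [moduleCharacter_eq_sum_finrank_hom hV hs, Finset.sum_congr rfl fun i _ => hterm i,
    Finset.sum_add_distrib, ← Finset.mul_sum, ← moduleCharacter_eq_sum hV, ← Finset.sum_filter,
    Finset.sum_const, hcard]
  ring

/-- The valencies are determined by the relation between the standard, regular and principal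
characters. -/
theorem valency_eq {c : ℚ} (hc : ∀ s, moduleCharacter A (Ω → ℂ) (D.op s) =
      c * (moduleCharacter A A (D.op s) - X.valency s) + X.valency s) {s₀ : X.rels} (hs₀ : s₀ ≠ X.diag) :
    ∀ s, s ≠ X.diag → X.valency s = X.valency s₀ ∧ ∑ t, X.interNum s t t + 1 = X.valency s := by
  have := D.finiteDimensional
  -- Evaluation at the identity, where the regular character is |S|.
  have hdiag : (Fintype.card Ω : ℚ) = c * (Fintype.card X.rels - 1) + 1 := by
    have := hc X.diag
    rw [D.moduleCharacter_standard, if_pos rfl, D.op_diag, valency_diag,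
      moduleCharacter_of_smul_eq (c := 1) (by simp),
      Module.finrank_eq_card_basis D.basis] at this
    have h2 : ((Fintype.card Ω : ℚ) : ℂ) =
        ((c * (Fintype.card X.rels - 1) + 1 : ℚ) : ℂ) := by
      push_cast
      rw [this]
      push_cast
      ring
    exact_mod_cast h2
  have hne : ∀ s, s ≠ X.diag →
      c * ((X.valency s : ℚ) - ∑ t, (X.interNum s t t : ℚ)) = X.valency s := by
    intro s hs
    have := hc s
    rw [D.moduleCharacter_standard, if_neg hs, D.moduleCharacter_regular] at this
    have h2 : ((c * ((X.valency s : ℚ) - ∑ t, (X.interNum s t t : ℚ)) : ℚ) : ℂ) =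
        ((X.valency s : ℚ) : ℂ) := by
      push_cast
      linear_combination this
    exact_mod_cast h2
  have hvpos : ∀ s, (0 : ℚ) < X.valency s := fun s => by exact_mod_cast X.valency_pos s
  have hsum : ∑ s ∈ Finset.univ.erase X.diag, (X.valency s : ℚ) =
      ∑ s ∈ Finset.univ.erase X.diag, c := by
    have h1 := Finset.add_sum_erase Finset.univ (fun s => (X.valency s : ℚ))
      (Finset.mem_univ X.diag)
    rw [← Nat.cast_sum Finset.univ, X.sum_valency, hdiag, valency_diag] at h1
    rw [Finset.sum_const, Finset.card_erase_of_mem (Finset.mem_univ _), nsmul_eq_mul,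
      Finset.card_univ, Nat.cast_sub (Fintype.card_pos_iff.2 ⟨s₀⟩)]
    push_cast at h1 ⊢
    linarith
  have hcpos : 0 < c := by
    have h1 : 0 < ∑ s ∈ Finset.univ.erase X.diag, (X.valency s : ℚ) :=
      Finset.sum_pos (fun s _ => hvpos s) ⟨s₀, by simpa using hs₀⟩
    rw [hsum, Finset.sum_const, nsmul_eq_mul] at h1
    exact pos_of_mul_pos_right h1 (Nat.cast_nonneg _)
  -- The integer n_s - ∑ₜ c_{st}^t is positive because its product with c > 0 is n_s; hence it is at
  -- least 1.
  have hle : ∀ s ∈ Finset.univ.erase X.diag, c ≤ X.valency s := by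
    intro s hs
    have h1 := hne s (Finset.ne_of_mem_erase hs)
    have h2 : (0 : ℚ) < (X.valency s : ℚ) - ∑ t, (X.interNum s t t : ℚ) :=
      pos_of_mul_pos_right ((hvpos s).trans_eq h1.symm) hcpos.le
    have h3 : (1 : ℚ) ≤ (X.valency s : ℚ) - ∑ t, (X.interNum s t t : ℚ) := by
      have h4 : ∑ t, X.interNum s t t < X.valency s := by
        rw [sub_pos] at h2
        exact_mod_cast h2
      rw [le_sub_iff_add_le, add_comm]
      exact_mod_cast h4
    nlinarith
  -- Termwise inequality with equal sums forces n_s = c throughout.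
  have heq := (Finset.sum_eq_sum_iff_of_le hle).1 hsum.symm
  intro s hs
  have h1 := heq s (by simpa using hs)
  have h2 := heq s₀ (by simpa using hs₀)
  refine ⟨by exact_mod_cast h1.symm.trans h2, ?_⟩
  have h3 := hne s hs
  rw [← h1] at h3
  have h4 : (X.valency s : ℚ) - ∑ t, (X.interNum s t t : ℚ) = 1 := by
    rw [← h1]
    exact mul_left_cancel₀ hcpos.ne' (h3.trans (mul_one c).symm)
  have h5 : (∑ t, (X.interNum s t t : ℚ)) + 1 = X.valency s := by linarith
  exact_mod_cast h5

end AdjacencyAction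

end AdjacencyAction

/-! ### Valencies and indistinguishing numbers of pseudocyclic schemes. -/

section Pseudocyclic

variable {X}

instance : IsScalarTower ℂ X.adjAlgebra (Ω → ℂ) := ⟨fun _ _ _ => rfl⟩

/-- The action of the adjacency algebra on the standard module. -/
noncomputable def adjacencyAction (X : AssociationScheme Ω) :
    AdjacencyAction X X.adjAlgebra where
  op := X.adj
  span_op := X.span_adj
  op_smul_apply := X.adj_smul_apply
  op_diag := X.adj_diag
  op_mul_op := X.adj_mul_adj

/-- All nondiagonal basis relations of a pseudocyclic scheme have the same valency. -/
theorem IsPseudocyclic.valency_eq (h : X.IsPseudocyclic) {s₀ : X.rels} (hs₀ : s₀ ≠ X.diag) :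
    ∀ s, s ≠ X.diag → X.valency s = X.valency s₀ ∧ ∑ t, X.interNum s t t + 1 = X.valency s := by
  obtain ⟨c, hc⟩ := h
  exact X.adjacencyAction.valency_eq (X.adjacencyAction.moduleCharacter_standard_eq hc) hs₀

theorem IsPseudocyclic.card_indistinguishing_lt (h : X.IsPseudocyclic) {s₀ : X.rels}
    (hs₀ : s₀ ≠ X.diag) {α β : Ω} (hne : α ≠ β) :
    (Finset.univ.filter fun γ => X.rel α γ = X.rel β γ).card < X.valency s₀ := by
  have hs : X.rel α β ≠ X.diag := X.rel_eq_diag.not.2 hne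
  obtain ⟨h1, h2⟩ := h.valency_eq hs₀ _ hs
  rw [X.card_indistinguishing, ← h1, ← h2, Nat.lt_succ_iff]
  refine Finset.sum_le_sum fun t _ => ?_
  by_cases ht : t = X.diag
  · have h3 : X.interNum t (X.star t) (X.rel α β) = 0 := by
      rw [← not_ne_iff, ← pos_iff_ne_zero, X.interNum_rel_pos]
      rintro ⟨γ, h4, h5⟩
      rw [ht, X.rel_eq_diag] at h4
      rw [ht, ← h4, ← X.rel_self α, X.star_rel, X.rel_self] at h5
      exact hs h5
    rw [h3]
    exact Nat.zero_le _
  -- With s the relation of `α` to `β`, equal valencies give c_{st}^t = c_{tt*}^s.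
  · have h3 := X.interNum_mul_valency (X.rel α β) t t
    rw [h1, (h.valency_eq hs₀ t ht).1] at h3
    exact (Nat.eq_of_mul_eq_mul_right (X.valency_pos s₀) h3).symm.le

end Pseudocyclic

end AssociationScheme

theorem mainTheorem2 :
    ∃ f : ℕ → ℕ, (∀ k : ℕ, f k ≤ 1 + 3 * k ^ 6) ∧
      ∀ (k : ℕ), 1 < k → ∀ (Ω : Type u) [Fintype Ω] (X : AssociationScheme Ω),
        X.IsPseudocyclic → (∃ s : X.rels, s ≠ X.diag ∧ X.valency s = k) →
        f k ≤ Fintype.card Ω →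
          X.IsSchurian ∧ AssociationScheme.IsSeparable.{u, v} X := by
  refine ⟨fun k => 1 + 3 * k ^ 6, fun k => le_rfl, ?_⟩
  rintro k hk Ω _ X hX ⟨s₀, hs₀, rfl⟩ hn
  have h1 : ∀ s, s ≠ X.diag → X.valency s = X.valency s₀ := fun s hs => (hX.valency_eq hs₀ s hs).1
  have h2 : ∀ s, X.valency s ≤ X.valency s₀ := by
    intro s
    by_cases hs : s = X.diag
    · rw [hs, X.valency_diag]
      exact hk.le
    · exact (h1 s hs).le
  have h3 := fun (α β : Ω) (hne : α ≠ β) => (hX.card_indistinguishing_lt hs₀ hne).le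
  -- As k ≥ 2, k³ ≥ 8 and so 6k³ < 3k⁶.
  have h4 : 1 + 6 * X.valency s₀ ^ 3 < Fintype.card Ω := by
    refine lt_of_lt_of_le ?_ hn
    have h5 : 2 ^ 3 ≤ X.valency s₀ ^ 3 := Nat.pow_le_pow_left hk 3
    have h6 : X.valency s₀ ^ 6 = X.valency s₀ ^ 3 * X.valency s₀ ^ 3 := by ring
    change _ < 1 + 3 * X.valency s₀ ^ 6
    rw [h6]
    nlinarith
  exact ⟨AssociationScheme.isSchurian_of_indistinguishing h1 h2 h3 h4,
    AssociationScheme.isSeparable_of_indistinguishing h1 h2 h3 h4⟩
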